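/- All topological spaces are Hausdorff and all Banach spaces are real and nonzero. For a compact space $K$ and a Banach space $E$, $\mathcal C(K,E)$ is the Banach space of continuous functions $K\to E$ with the supremum norm. For a topological space $S$ put $S^{(0)}=S$, let $S^{(\alpha+1)}$ be the set of accumulation points of the space $S^{(\alpha)}$, and $S^{(\alpha)}=\bigcap_{\beta<\alpha}S^{(\beta)}$ for limit ordinals $\alpha$; $S$ is scattered if $S^{(\alpha)}=\emptyset$ for some ordinal $\alpha$, and the least such $\alpha$ is the height $ht(S)$ of $S$. A statement about $ht(S)$ includes that $S$ is scattered. An into isomorphism is a linear homeomorphism $T$ onto a linear subspace of the target space; $T^{-1}$ is defined on the range of $T$, and $\|T\|$, $\|T^{-1}\|$ are operator norms. A Banach space contains an isomorphic copy of $X$ ($X$ embeds isomorphically into it) if there is an into isomorphism from $X$ to it; $c_0$ is the space of real null sequences with the supremum norm. Let $K_1,K_2$ be infinite compact spaces and let $E_1,E_2$ be Banach spaces such that $E_2$ does not contain an isomorphic copy of $c_0$. (i) If $l,k\in\mathbb N$, $l>k$, $ht(K_1)=l$, $ht(K_2)=k$, and $T:\mathcal C(K_1,E_1)\to\mathcal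 C(K_2,E_2)$ is an into isomorphism, then $$\|T\|\,\|T^{-1}\|\ \ge\ \max\Big\{3,\ \frac{2l-k-1}{k-1}\Big\}.$$ (Here $k\ge 2$, because $K_2$ is infinite and compact.) (ii) If $\mathcal C(K_1,E_1)$ embeds isomorphically into $\mathcal C(K_2,E_2)$ and $ht(K_2)$ is finite, then $ht(K_1)$ is finite. -/

import Mathlib

open scoped ZeroAtInfty CantorBendixson

/-- A topological space `S` is scattered if some transfinite derivative of `S` is empty.
Here `Set.univᵈ[α]` is the `α`-th Cantor–Bendixson derivative of the whole space: the whole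
space at `0`, the accumulation points of the previous stage at successors, and the intersection of
the earlier stages at limits. -/
def IsScatteredSpace (S : Type*) [TopologicalSpace S] : Prop :=
  ∃ α : Ordinal, (Set.univ : Set S)ᵈ[α] = ∅

/-- The height of a scattered space `S`: the least ordinal `α` such that the `α`-th derivative of
`S` is empty. It is only meaningful together with `IsScatteredSpace S`. -/
noncomputable def scatteredHeight (S : Type*) [TopologicalSpace S] : Ordinal :=
  sInf {α : Ordinal | (Set.univ : Set S)ᵈ[α] = ∅}

/-- `X` embeds isomorphically into `Y`, that is, `Y` contains an isomorphic copy of `X`: there is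
a linear homeomorphism of `X` onto a linear subspace of `Y`. -/
def EmbedsIsomorphically (X Y : Type*) [NormedAddCommGroup X] [NormedSpace ℝ X]
    [NormedAddCommGroup Y] [NormedSpace ℝ Y] : Prop :=
  ∃ H : Submodule ℝ Y, Nonempty (X ≃L[ℝ] H)

/-- `Y` contains an isomorphic copy of `c₀`, the Banach space `C₀(ℕ, ℝ)` of real null sequences
with the supremum norm. -/
def ContainsCopyOfCZero (Y : Type*) [NormedAddCommGroup Y] [NormedSpace ℝ Y] : Prop :=
  EmbedsIsomorphically C₀(ℕ, ℝ) Y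

/-! Multiplying by a unit vector of `E₁` reduces to S : C(K₁, ℝ) → C(K₂, E₂) with ‖Sf‖ ≤ A‖f‖ and
‖f‖ ≤ B‖Sf‖. A point in the m-th derivative of K₁ yields bumps g₁ ≥ … ≥ gₘ with values in [0,1] and
a common point of value 1. Since E₂ has no copy of c₀, S sends disjoint bumps to functions that are
small at any fixed point, with finitely many exceptions. So each bump that stays large costs a
derivative of K₂: if its k-th derivative is empty, fewer than k bumps have ‖S g(y)‖ ≥ δ at a point y
where a prescribed combination attains its norm (`exists_chain_and_mem_derivative`,
`exists_chain_countP_lt`).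

Changing the combination by the bumps that are small at y hardly alters its image there, but can
lower its norm. The function 1 + 2gₘ has norm at least 3, and subtracting 2g for a small g leaves
norm at most 1, so AB ≥ 3. With h = (k-1)/2, the function -h + ∑ gᵢ has norm at least m - h, and its
large part has norm at most h, so m - h ≤ ABh. Taking m = l - 1 gives (i); the bound on m gives
(ii). -/

open scoped ENNReal in
/-- **Rosenthal's lemma**: a nonnegative infinite matrix with bounded row sums has an infinite
submatrix whose off-diagonal row sums are small. -/
theorem exists_injective_tsum_offDiag_le {ε : ℝ≥0∞} (hε : ε ≠ ⊤) (N : ℕ) :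
    ∀ m : ℕ → ℕ → ℝ≥0∞, (∀ n, ∑' k, m n k ≤ N * ε) →
      ∃ φ : ℕ → ℕ, Function.Injective φ ∧
        ∀ n, ∑' k : {k // k ≠ n}, m (φ n) (φ k) ≤ ε := by
  induction N with
  | zero =>
    intro m hm
    refine ⟨id, Function.injective_id, fun n => ?_⟩
    refine (ENNReal.tsum_comp_le_tsum_of_injective Subtype.val_injective (m n)).trans ?_
    exact (hm n).trans (by simp)
  | succ N ih =>
    intro m hm
    -- Split ℕ into infinitely many infinite blocks. If every block p has a bad index q p, the
    -- transversal of bad indices avoids more than ε of each row sum, leaving at most N * ε.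
    let e : ℕ × ℕ ≃ ℕ := Nat.pairEquiv
    by_cases h : ∃ p, ∀ n, ∑' k : {k // k ≠ n}, m (e (p, n)) (e (p, k)) ≤ ε
    · obtain ⟨p, hp⟩ := h
      refine ⟨fun n => e (p, n), fun a b hab => ?_, hp⟩
      simpa using e.injective hab
    · push Not at h
      choose q hq using h
      have hinj : Function.Injective fun p => e (p, q p) := by
        intro a b hab
        exact congrArg Prod.fst (e.injective hab)
      obtain ⟨φ, hφ, h⟩ := ih (fun p p' => m (e (p, q p)) (e (p', q p'))) fun p => by
        let s : ℕ ⊕ {k // k ≠ q p} → ℕ :=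
          Sum.elim (fun p' => e (p', q p')) (fun k => e (p, k))
        have hs : Function.Injective s := by
          rintro (a | a) (b | b) hab
          · simpa using hinj hab
          · have := e.injective hab
            simp only [Prod.mk.injEq] at this
            exact absurd (this.2.symm.trans (congrArg q this.1)) b.2
          · have := e.injective hab
            simp only [Prod.mk.injEq] at this
            exact absurd (this.2.trans (congrArg q this.1.symm)) a.2
          · have := e.injective hab
            simp only [Prod.mk.injEq, true_and] at this
            rw [Subtype.ext this]
        have h1 := (ENNReal.tsum_comp_le_tsum_of_injective hs (m (e (p, q p)))).trans
          (hm (e (p, q p)))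
        rw [ENNReal.summable.tsum_sum ENNReal.summable] at h1
        have h2 : (∑' p', m (e (p, q p)) (e (p', q p'))) + ε ≤ N * ε + ε := by
          refine (add_le_add_right (hq p).le _).trans (h1.trans (le_of_eq ?_))
          push_cast
          ring
        exact (ENNReal.add_le_add_iff_right hε).1 h2
      exact ⟨fun n => e (φ n, q (φ n)), hinj.comp hφ, h⟩

/-! ### Weakly unconditionally Cauchy series and copies of c₀ -/

section CZero

variable {E : Type*} [NormedAddCommGroup E] [NormedSpace ℝ E]

theorem norm_sum_smul_le_of_forall_abs_le {x : ℕ → E} {C : ℝ}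
    (hC : ∀ (F : Finset ℕ) (a : ℕ → ℝ), (∀ n ∈ F, |a n| ≤ 1) → ‖∑ n ∈ F, a n • x n‖ ≤ C)
    {F : Finset ℕ} {a : ℕ → ℝ} {r : ℝ} (hr : 0 < r) (ha : ∀ n ∈ F, |a n| ≤ r) :
    ‖∑ n ∈ F, a n • x n‖ ≤ C * r := by
  have h := hC F (fun n => r⁻¹ * a n) fun n hn => by
    rw [abs_mul, abs_of_pos (inv_pos.2 hr), inv_mul_le_iff₀ hr, mul_one]
    exact ha n hn
  simp_rw [mul_smul, ← Finset.smul_sum, norm_smul, Real.norm_eq_abs,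
    abs_of_pos (inv_pos.2 hr)] at h
  rwa [inv_mul_le_iff₀ hr, mul_comm] at h

theorem sum_abs_apply_le_of_forall_norm_sum_le {x : ℕ → E} {C : ℝ}
    (hC : ∀ (F : Finset ℕ) (a : ℕ → ℝ), (∀ n ∈ F, |a n| ≤ 1) → ‖∑ n ∈ F, a n • x n‖ ≤ C)
    {f : E →L[ℝ] ℝ} (hf : ‖f‖ ≤ 1) (F : Finset ℕ) :
    ∑ n ∈ F, |f (x n)| ≤ C := by
  have h := hC F (fun n => SignType.sign (f (x n))) fun n _ => by
    rcases lt_trichotomy (f (x n)) 0 with h | h | h <;> simp [h]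
  calc ∑ n ∈ F, |f (x n)| = f (∑ n ∈ F, (SignType.sign (f (x n)) : ℝ) • x n) := by
        simp [map_sum, sign_mul_self]
    _ ≤ ‖f (∑ n ∈ F, (SignType.sign (f (x n)) : ℝ) • x n)‖ := le_abs_self _
    _ ≤ ‖f‖ * ‖∑ n ∈ F, (SignType.sign (f (x n)) : ℝ) • x n‖ := f.le_opNorm _
    _ ≤ 1 * C := by gcongr
    _ = C := one_mul C

theorem ZeroAtInftyContinuousMap.abs_apply_le_norm (a : C₀(ℕ, ℝ)) (n : ℕ) : |a n| ≤ ‖a‖ := by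
  rw [← ZeroAtInftyContinuousMap.norm_toBCF_eq_norm]
  exact a.toBCF.norm_coe_le_norm n

theorem summable_smul_of_forall_norm_sum_le [CompleteSpace E] {x : ℕ → E} {C : ℝ}
    (hC : ∀ (F : Finset ℕ) (a : ℕ → ℝ), (∀ n ∈ F, |a n| ≤ 1) → ‖∑ n ∈ F, a n • x n‖ ≤ C)
    (a : C₀(ℕ, ℝ)) : Summable fun n => a n • x n := by
  rw [summable_iff_vanishing_norm]
  intro ε hε
  have hC0 : 0 ≤ C := by simpa using hC ∅ 0
  have hr : 0 < ε / (C + 1) := by positivity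
  have ht : Filter.Tendsto a Filter.cofinite (nhds 0) := by
    rw [← Filter.cocompact_eq_cofinite]
    exact a.zero_at_infty'
  have h : {n | ¬ |a n| < ε / (C + 1)}.Finite := by
    have := ht.eventually (Metric.ball_mem_nhds 0 hr)
    simpa [Filter.eventually_cofinite] using this
  refine ⟨h.toFinset, fun t hts => ?_⟩
  refine (norm_sum_smul_le_of_forall_abs_le hC hr (a := a) fun n hn => ?_).trans_lt ?_
  · by_contra hcon
    exact Finset.disjoint_left.1 hts hn (h.mem_toFinset.2 fun h => hcon h.le)
  · rw [mul_div_assoc', div_lt_iff₀ (by positivity)]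
    nlinarith

/-- A form of the Bessaga-Pełczyński theorem: a weakly unconditionally Cauchy series whose terms
are bounded away from zero produces a copy of `c₀`. -/
theorem containsCopyOfCZero_of_forall_norm_sum_le [CompleteSpace E] {x : ℕ → E} {C δ : ℝ}
    (hδ : 0 < δ)
    (hC : ∀ (F : Finset ℕ) (a : ℕ → ℝ), (∀ n ∈ F, |a n| ≤ 1) → ‖∑ n ∈ F, a n • x n‖ ≤ C)
    (hx : ∀ n, δ ≤ ‖x n‖) : ContainsCopyOfCZero E := by
  have hC0 : 0 ≤ C := by simpa using hC ∅ 0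
  choose f hf hfx using fun n => exists_dual_vector'' ℝ (x n)
  obtain ⟨N, hN⟩ := exists_nat_ge (C / (δ / 2))
  obtain ⟨φ, hφ, hoff⟩ := exists_injective_tsum_offDiag_le
    (ε := ENNReal.ofReal (δ / 2)) ENNReal.ofReal_ne_top N
    (fun n k => ENNReal.ofReal |f n (x k)|) fun n => by
      refine ENNReal.summable.tsum_le_of_sum_le fun F => ?_
      rw [← ENNReal.ofReal_sum_of_nonneg fun _ _ => abs_nonneg _, ← ENNReal.ofReal_natCast,
        ← ENNReal.ofReal_mul (Nat.cast_nonneg _)]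
      refine ENNReal.ofReal_le_ofReal
        ((sum_abs_apply_le_of_forall_norm_sum_le hC (hf n) F).trans ?_)
      rwa [div_le_iff₀ (by positivity)] at hN
  have hC' : ∀ (F : Finset ℕ) (a : ℕ → ℝ), (∀ n ∈ F, |a n| ≤ 1) →
      ‖∑ n ∈ F, a n • x (φ n)‖ ≤ C := by
    intro F a ha
    have h := hC (F.map ⟨φ, hφ⟩) (fun j => a (Function.invFun φ j)) (by
      simpa [Function.leftInverse_invFun hφ _] using ha)
    simpa [Function.leftInverse_invFun hφ _] using h
  have hsum := summable_smul_of_forall_norm_sum_le hC'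
  have hbound : ∀ a : C₀(ℕ, ℝ), ‖∑' n, a n • x (φ n)‖ ≤ C * ‖a‖ := by
    intro a
    rcases (norm_nonneg a).eq_or_lt with h0 | h0
    · have : a = 0 := norm_eq_zero.1 h0.symm
      simp [this]
    · refine le_of_tendsto (hsum a).hasSum.norm (Filter.Eventually.of_forall fun F => ?_)
      exact norm_sum_smul_le_of_forall_abs_le hC' h0 fun n _ => a.abs_apply_le_norm n
  let J₀ : C₀(ℕ, ℝ) →ₗ[ℝ] E :=
    { toFun := fun a => ∑' n, a n • x (φ n)
      map_add' := fun a b => by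
        simp only [ZeroAtInftyContinuousMap.add_apply, add_smul]
        exact (hsum a).tsum_add (hsum b)
      map_smul' := fun c a => by
        simp only [ZeroAtInftyContinuousMap.smul_apply, smul_assoc, RingHom.id_apply]
        exact (hsum a).tsum_const_smul c }
  let J : C₀(ℕ, ℝ) →L[ℝ] E := J₀.mkContinuous C hbound
  have hJ : ∀ a, J a = ∑' n, a n • x (φ n) := fun a => rfl
  have hrow : ∀ n, Summable fun k : {k // k ≠ n} => |f (φ n) (x (φ k))| := by
    intro n
    have := ENNReal.summable_toReal
      ((hoff n).trans_lt ENNReal.ofReal_lt_top).ne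
    simpa using this
  have hrow' : ∀ n, ∑' k : {k // k ≠ n}, |f (φ n) (x (φ k))| ≤ δ / 2 := by
    intro n
    have h := hoff n
    rw [← ENNReal.ofReal_tsum_of_nonneg (fun _ => abs_nonneg _) (hrow n)] at h
    exact (ENNReal.ofReal_le_ofReal_iff (by positivity)).1 h
  -- The norming functional of the n-th vector sees the diagonal term, of size at least δ|a n|, up
  -- to an off-diagonal error controlled by Rosenthal's lemma.
  have hcoord : ∀ a n, δ * |a n| ≤ ‖J a‖ + δ / 2 * ‖a‖ := by
    intro a n
    have hs : Summable fun k => a k * f (φ n) (x (φ k)) := by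
      simpa using (f (φ n)).summable (hsum a)
    have h1 : f (φ n) (J a) = a n * f (φ n) (x (φ n)) +
        ∑' k : {k // k ≠ n}, a k * f (φ n) (x (φ k)) := by
      rw [hJ, (f (φ n)).map_tsum (hsum a)]
      simp only [map_smul, smul_eq_mul]
      have := (hs.tsum_subtype_add_tsum_subtype_compl {n})
      rw [← this]
      simp
      rfl
    have h2 : |∑' k : {k // k ≠ n}, a k * f (φ n) (x (φ k))| ≤ δ / 2 * ‖a‖ := by
      have hle : ∀ k : {k // k ≠ n}, ‖a k * f (φ n) (x (φ k))‖ ≤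
          ‖a‖ * |f (φ n) (x (φ k))| := fun k => by
        rw [norm_mul]
        exact mul_le_mul_of_nonneg_right (a.abs_apply_le_norm _) (abs_nonneg _)
      refine (tsum_of_norm_bounded ((hrow n).mul_left ‖a‖).hasSum hle).trans ?_
      rw [tsum_mul_left, mul_comm]
      exact mul_le_mul_of_nonneg_right (hrow' n) (norm_nonneg _)
    have h3 : |f (φ n) (J a)| ≤ ‖J a‖ := by
      simpa using (f (φ n)).le_of_opNorm_le (hf _) (J a)
    have h4 : δ * |a n| ≤ |a n * f (φ n) (x (φ n))| := by
      rw [abs_mul, mul_comm, hfx]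
      simpa using mul_le_mul_of_nonneg_left (hx (φ n)) (abs_nonneg (a n))
    have h5 : a n * f (φ n) (x (φ n)) = f (φ n) (J a) -
        ∑' k : {k // k ≠ n}, a k * f (φ n) (x (φ k)) := by rw [h1]; ring
    rw [h5] at h4
    exact h4.trans ((abs_sub _ _).trans (add_le_add h3 h2))
  have hlow : ∀ a, δ / 2 * ‖a‖ ≤ ‖J a‖ := by
    intro a
    have h : ‖a‖ ≤ (‖J a‖ + δ / 2 * ‖a‖) / δ := by
      rw [← ZeroAtInftyContinuousMap.norm_toBCF_eq_norm,
        BoundedContinuousFunction.norm_le (by positivity)]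
      intro n
      rw [le_div_iff₀ hδ, mul_comm]
      exact hcoord a n
    rw [le_div_iff₀ hδ] at h
    linarith
  have hanti : AntilipschitzWith (Real.toNNReal (δ / 2)⁻¹) J := by
    refine AddMonoidHomClass.antilipschitz_of_bound J fun a => ?_
    rw [Real.coe_toNNReal _ (by positivity), le_inv_mul_iff₀ (by positivity)]
    exact hlow a
  exact ⟨_, ⟨J.equivRange hanti.injective (hanti.isClosed_range J.uniformContinuous)⟩⟩

end CZero

/-! ### Operators on disjoint functions -/

section Disjoint

variable {K E : Type*} [TopologicalSpace K] [CompactSpace K]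
  [NormedAddCommGroup E] [NormedSpace ℝ E]

theorem norm_sum_smul_le_one_of_disjoint {g : ℕ → C(K, ℝ)} (hg : ∀ n z, |g n z| ≤ 1)
    (hd : ∀ i j, i ≠ j → ∀ z, g i z = 0 ∨ g j z = 0)
    (F : Finset ℕ) (a : ℕ → ℝ) (ha : ∀ n ∈ F, |a n| ≤ 1) :
    ‖∑ n ∈ F, a n • g n‖ ≤ 1 := by
  rw [ContinuousMap.norm_le _ zero_le_one]
  intro z
  simp only [ContinuousMap.sum_apply, ContinuousMap.smul_apply, smul_eq_mul]
  by_cases h : ∃ i ∈ F, g i z ≠ 0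
  · obtain ⟨i, hi, hne⟩ := h
    rw [Finset.sum_eq_single_of_mem i hi fun j _ hji => by
      rw [(hd j i hji z).resolve_right hne, mul_zero], norm_mul]
    exact mul_le_one₀ (ha i hi) (norm_nonneg _) (hg i z)
  · push Not at h
    rw [Finset.sum_eq_zero fun i hi => by rw [h i hi, mul_zero]]
    simp

/-- An operator from `C(K, ℝ)` into a space without copies of `c₀` is small on all but finitely
many members of a disjoint sequence of functions. -/
theorem finite_setOf_le_norm_apply_of_disjoint [CompleteSpace E] (hE : ¬ ContainsCopyOfCZero E)
    (R : C(K, ℝ) →L[ℝ] E) {g : ℕ → C(K, ℝ)} (hg : ∀ n z, |g n z| ≤ 1)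
    (hd : ∀ i j, i ≠ j → ∀ z, g i z = 0 ∨ g j z = 0) {δ : ℝ} (hδ : 0 < δ) :
    {n | δ ≤ ‖R (g n)‖}.Finite := by
  by_contra hinf
  let e := Set.Infinite.natEmbedding _ hinf
  refine hE (containsCopyOfCZero_of_forall_norm_sum_le (x := fun n => R (g (e n)))
    (C := ‖R‖) hδ (fun F a ha => ?_) fun n => (e n).2)
  have h := norm_sum_smul_le_one_of_disjoint (g := fun n => g (e n)) (fun n => hg _)
    (fun i j hij => hd _ _ fun h => hij (e.injective (Subtype.ext h))) F a ha
  calc ‖∑ n ∈ F, a n • R (g (e n))‖ = ‖R (∑ n ∈ F, a n • g (e n))‖ := by simp [map_sum]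
    _ ≤ ‖R‖ * 1 := R.le_opNorm_of_le h
    _ = ‖R‖ := mul_one _

end Disjoint

/-! ### Derived sets, separated points and bumps -/

section Derivative

variable {X : Type*} [TopologicalSpace X]

theorem iteratedDerivedSet_natCast (s : Set X) (n : ℕ) :
    sᵈ[(n : Ordinal)] = (relDerivedSet : Set X →o Set X)^[n] s := by
  induction n with
  | zero => simp
  | succ n ih =>
    rw [Nat.cast_succ, CantorBendixson.iteratedDerivedSet_succ, ih, Function.iterate_succ_apply']

theorem isClosed_iterate_relDerivedSet [T1Space X] (n : ℕ) :
    IsClosed ((relDerivedSet : Set X →o Set X)^[n] Set.univ) := by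
  rw [← iteratedDerivedSet_natCast]
  exact CantorBendixson.isClosed_iteratedDerivedSet isClosed_univ _

theorem antitone_iterate_relDerivedSet (s : Set X) :
    Antitone fun n : ℕ => (relDerivedSet : Set X →o Set X)^[n] s :=
  antitone_nat_of_succ_le fun n => by
    rw [Function.iterate_succ_apply']
    exact relDerivedSet_subset

/-- Separate x from a point of A, then repeat inside the smaller neighbourhood of x. -/
theorem AccPt.exists_seq_disjoint_isOpen [T2Space X] {x : X} {A : Set X}
    (hx : AccPt x (Filter.principal A)) {U : Set X} (hU : IsOpen U) (hxU : x ∈ U) :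
    ∃ (p : ℕ → X) (W : ℕ → Set X), (∀ n, p n ∈ A) ∧ (∀ n, p n ∈ W n) ∧ (∀ n, IsOpen (W n)) ∧
      (∀ n, W n ⊆ U) ∧ ∀ i j, i ≠ j → Disjoint (W i) (W j) := by
  have step : ∀ V : {V : Set X // IsOpen V ∧ x ∈ V}, ∃ (V' : {V : Set X // IsOpen V ∧ x ∈ V})
      (W : Set X) (p : X), V'.1 ⊆ V.1 ∧ W ⊆ V.1 ∧ Disjoint V'.1 W ∧ IsOpen W ∧ p ∈ W ∧ p ∈ A := by
    rintro ⟨V, hV, hxV⟩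
    obtain ⟨p, ⟨hpV, hpA⟩, hpx⟩ := accPt_iff_nhds.1 hx V (hV.mem_nhds hxV)
    obtain ⟨u, v, hu, hv, hxu, hpv, huv⟩ := t2_separation hpx.symm
    exact ⟨⟨u ∩ V, hu.inter hV, hxu, hxV⟩, v ∩ V, p, Set.inter_subset_right,
      Set.inter_subset_right, huv.mono Set.inter_subset_left Set.inter_subset_left,
      hv.inter hV, ⟨hpv, hpV⟩, hpA⟩
  choose V' W p hV'V hWV hdis hW hpW hpA using step
  let S : ℕ → {V : Set X // IsOpen V ∧ x ∈ V} := fun n => V'^[n] ⟨U, hU, hxU⟩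
  have hS : ∀ n, S (n + 1) = V' (S n) := fun n => Function.iterate_succ_apply' _ _ _
  have hanti : Antitone fun n => (S n).1 := antitone_nat_of_succ_le fun n => by
    rw [hS]
    exact hV'V _
  have hlt : ∀ i j, i < j → Disjoint (W (S i)) (W (S j)) := fun i j hij => by
    have h := hdis (S i)
    rw [← hS] at h
    exact h.symm.mono_right ((hWV _).trans (hanti (Nat.succ_le_of_lt hij)))
  refine ⟨fun n => p (S n), fun n => W (S n), fun n => hpA _, fun n => hpW _, fun n => hW _,
    fun n => (hWV _).trans (hanti (Nat.zero_le n)), fun i j hij => ?_⟩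
  rcases hij.lt_or_gt with h | h
  · exact hlt i j h
  · exact (hlt j i h).symm

/-- The value 1 on all of V makes every later bump supported in V lie below g. -/
theorem exists_continuousMap_one_near_of_mem_isOpen [CompactSpace X] [T2Space X] {x : X}
    {W : Set X} (hW : IsOpen W) (hx : x ∈ W) :
    ∃ (g : C(X, ℝ)) (V : Set X), IsOpen V ∧ x ∈ V ∧ V ⊆ W ∧ (∀ z ∈ V, g z = 1) ∧
      (∀ z, z ∉ W → g z = 0) ∧ ∀ z, g z ∈ Set.Icc (0 : ℝ) 1 := by
  obtain ⟨t, ht, htc, htW⟩ := exists_mem_nhds_isClosed_subset (hW.mem_nhds hx)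
  obtain ⟨f, hf0, hf1, hf⟩ := exists_continuous_zero_one_of_isClosed hW.isClosed_compl htc
    (Set.disjoint_compl_left_iff_subset.2 htW)
  exact ⟨f, interior t, isOpen_interior, mem_interior_iff_mem_nhds.2 ht,
    interior_subset.trans htW, fun z hz => hf1 (interior_subset hz), fun z hz => hf0 hz, hf⟩

/-- Points indexed by an infinite set, with finite fibres, accumulate somewhere. -/
theorem exists_accPt_of_infinite_of_finite_fibers [CompactSpace X] {y : ℕ → X} {N : Set ℕ}
    (hN : N.Infinite) (hfib : ∀ z, {n | y n = z}.Finite) :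
    ∃ z, AccPt z (Filter.principal (y '' N)) := by
  refine Set.Infinite.exists_accPt_principal fun hfin => hN ?_
  refine (hfin.biUnion (t := fun z => {n | y n = z}) fun z _ => hfib z).subset fun n hn => ?_
  exact Set.mem_biUnion (Set.mem_image_of_mem y hn) rfl

end Derivative

/-! ### Norm attainment and sums over lists -/

theorem exists_norm_apply_eq_norm {K E : Type*} [TopologicalSpace K] [CompactSpace K]
    [Nonempty K] [SeminormedAddCommGroup E] (f : C(K, E)) : ∃ y, ‖f y‖ = ‖f‖ := by
  obtain ⟨y, -, hy⟩ :=
    isCompact_univ.exists_isMaxOn Set.univ_nonempty f.continuous.norm.continuousOn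
  refine ⟨y, le_antisymm (f.norm_coe_le_norm y) ?_⟩
  exact (ContinuousMap.norm_le _ (norm_nonneg _)).2 fun z => hy (Set.mem_univ z)

theorem le_of_forall_pos_le_add_mul {a b c : ℝ} (h : ∀ δ > 0, a ≤ b + δ * c) : a ≤ b := by
  refine ge_of_tendsto (f := fun δ => b + δ * c) (x := nhdsWithin 0 (Set.Ioi 0)) ?_
    (Filter.eventually_of_mem self_mem_nhdsWithin h)
  have : Continuous fun δ : ℝ => b + δ * c := by fun_prop
  simpa using (this.tendsto 0).mono_left nhdsWithin_le_nhds

theorem sum_sub_sum_filter_eq {M : Type*} [AddCommGroup M] (q : M → Bool) (l : List M) :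
    l.sum - (l.filter q).sum = (l.filter fun x => !q x).sum := by
  induction l with
  | nil => simp
  | cons a l ih =>
    cases h : q a
    · simp [h, ← ih, add_sub_assoc]
    · simp [h, ← ih]

theorem sum_apply_mem_Icc_length {K : Type*} [TopologicalSpace K] {l : List C(K, ℝ)}
    (hl : ∀ g ∈ l, ∀ z, g z ∈ Set.Icc (0 : ℝ) 1) (z : K) :
    l.sum z ∈ Set.Icc (0 : ℝ) l.length := by
  induction l with
  | nil => simp
  | cons a l ih =>
    have h1 := ih fun g hg => hl g (List.mem_cons_of_mem _ hg)
    have h2 := hl a List.mem_cons_self z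
    simp only [List.sum_cons, ContinuousMap.add_apply, List.length_cons, Nat.cast_add, Nat.cast_one]
    exact ⟨add_nonneg h2.1 h1.1, by linarith [h2.2, h1.2]⟩

theorem norm_map_sum_le_length_mul {M E : Type*} [AddCommMonoid M] [SeminormedAddCommGroup E]
    (R : M →+ E) {δ : ℝ} {l : List M} (hl : ∀ g ∈ l, ‖R g‖ ≤ δ) :
    ‖R l.sum‖ ≤ δ * l.length := by
  induction l with
  | nil => simp
  | cons a l ih =>
    have h1 := ih fun g hg => hl g (List.mem_cons_of_mem _ hg)
    have h2 := hl a List.mem_cons_self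
    simp only [List.sum_cons, map_add, List.length_cons, Nat.cast_add, Nat.cast_one]
    exact (norm_add_le _ _).trans (by linarith)

theorem sum_apply_eq_length {K : Type*} [TopologicalSpace K] {l : List C(K, ℝ)} {p : K}
    (hl : ∀ g ∈ l, g p = 1) :
    l.sum p = l.length := by
  induction l with
  | nil => simp
  | cons a l ih =>
    simp [ih fun g hg => hl g (List.mem_cons_of_mem _ hg), hl a List.mem_cons_self, add_comm]

/-! ### Chains of bumps and the two estimates -/

section Chain

variable {K₁ K₂ E : Type*} [TopologicalSpace K₁] [CompactSpace K₁] [T2Space K₁]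
  [TopologicalSpace K₂] [CompactSpace K₂] [T2Space K₂]
  [NormedAddCommGroup E] [NormedSpace ℝ E] [CompleteSpace E]

/-- Evaluation at a point after an operator into `C(K₂, E)`. -/
noncomputable def evalAfter (S : C(K₁, ℝ) →L[ℝ] C(K₂, E)) (y : K₂) : C(K₁, ℝ) →L[ℝ] E :=
  (ContinuousMap.evalCLM ℝ y).comp S

open Classical in
/-- Given a point of the `s`-th derivative of `K₁` and a rule `F` choosing a point of `K₂` for each
list of functions, there is a decreasing chain `gs` of `s` bump functions such that `F gs` is close
to a point of the derivative of `K₂` whose order is the number of members of `gs` that `S` does not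
make small at `F gs`. -/
theorem exists_chain_and_mem_derivative (hE : ¬ ContainsCopyOfCZero E)
    (S : C(K₁, ℝ) →L[ℝ] C(K₂, E)) {δ : ℝ} (hδ : 0 < δ) (s : ℕ) :
    ∀ (F : List C(K₁, ℝ) → K₂) (x : K₁) (U : Set K₁) (Φ : Set C(K₂, E)) (η : ℝ),
      x ∈ (relDerivedSet : Set K₁ →o Set K₁)^[s] Set.univ → IsOpen U → x ∈ U → Φ.Finite → 0 < η →
      ∃ gs : List C(K₁, ℝ), gs.length = s ∧ (∀ g ∈ gs, ∀ z, g z ∈ Set.Icc (0 : ℝ) 1) ∧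
        (∀ g ∈ gs, ∀ z, z ∉ U → g z = 0) ∧ gs.Pairwise (fun f g => g ≤ f) ∧
        (∃ p ∈ U, ∀ g ∈ gs, g p = 1) ∧
        ∃ y ∈ (relDerivedSet : Set K₂ →o Set K₂)^[gs.countP (fun g => δ ≤ ‖S g (F gs)‖)] Set.univ,
          ∀ φ ∈ Φ, ‖φ y - φ (F gs)‖ ≤ η := by
  induction s with
  | zero =>
    intro F x U Φ η _ _ hxU _ hη
    exact ⟨[], rfl, by simp, by simp, by simp, ⟨x, hxU, by simp⟩, F [], by simp,
      by simpa using fun _ _ => hη.le⟩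
  | succ s ih =>
    intro F x U Φ η hx hU hxU hΦ hη
    rw [Function.iterate_succ_apply'] at hx
    obtain ⟨p, W, hp, hpW, hW, hWU, hdis⟩ :=
      AccPt.exists_seq_disjoint_isOpen (mem_derivedSet.1 hx.1) hU hxU
    choose g V hV hpV hVW hgV hgW hg using fun n =>
      exists_continuousMap_one_near_of_mem_isOpen (hW n) (hpW n)
    -- The point chosen by F depends on the completed list, so the induction uses the rule with g n
    -- prepended. Adding S (g n) to Φ carries its size from that point to y n.
    choose gs hlen hgs hsupp hsort hpeak y hy hyφ using fun n =>
      ih (fun l => F (g n :: l)) (p n) (V n) (insert (S (g n)) Φ) (min (η / 2) (δ / 2))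
        (hp n) (hV n) (hpV n) (hΦ.insert _) (by positivity)
    have hmain : ∃ n, ∃ y ∈ (relDerivedSet : Set K₂ →o Set K₂)^[(g n :: gs n).countP
        (fun f => δ ≤ ‖S f (F (g n :: gs n))‖)] Set.univ,
          ∀ φ ∈ Φ, ‖φ y - φ (F (g n :: gs n))‖ ≤ η := by
      by_cases hsmall : ∃ n, ‖S (g n) (F (g n :: gs n))‖ < δ
      · obtain ⟨n, hn⟩ := hsmall
        refine ⟨n, y n, ?_, fun φ hφ => ?_⟩
        · rw [List.countP_cons_of_neg (by simpa using hn)]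
          exact hy n
        · have := (hyφ n φ (Set.mem_insert_of_mem _ hφ)).trans (min_le_left _ _)
          linarith
      -- All the new bumps stay large, so no point equals y n for infinitely many n. Infinitely many
      -- y n share one derivative order c, and their accumulation point gains an order.
      · push Not at hsmall
        have hbig : ∀ n, δ / 2 ≤ ‖S (g n) (y n)‖ := fun n => by
          have h1 := (hyφ n _ (Set.mem_insert _ _)).trans (min_le_right _ _)
          have h2 := norm_sub_norm_le (S (g n) (F (g n :: gs n))) (S (g n) (y n))
          rw [norm_sub_rev] at h2
          linarith [hsmall n]
        have hfib : ∀ z, {n | y n = z}.Finite := fun z => by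
          refine (finite_setOf_le_norm_apply_of_disjoint hE (evalAfter S z) (g := g)
            (fun n z => ?_) (fun i j hij z => ?_) (half_pos hδ)).subset fun n hn => ?_
          · rw [abs_of_nonneg (hg n z).1]
            exact (hg n z).2
          · by_cases hz : z ∈ W i
            · exact Or.inr (hgW j z fun hz' => Set.disjoint_left.1 (hdis i j hij) hz hz')
            · exact Or.inl (hgW i z hz)
          · have := hbig n
            rw [show y n = z from hn] at this
            exact this
        let r : ℕ → Fin (s + 1) := fun n =>
          ⟨(gs n).countP (fun f => δ ≤ ‖S f (F (g n :: gs n))‖),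
            Nat.lt_succ_of_le (List.countP_le_length.trans (hlen n).le)⟩
        obtain ⟨c, hc⟩ := Finite.exists_infinite_fiber r
        have hN : (r ⁻¹' {c}).Infinite := Set.infinite_coe_iff.1 hc
        obtain ⟨z, hz⟩ := exists_accPt_of_infinite_of_finite_fibers hN hfib
        have hsub : y '' (r ⁻¹' {c}) ⊆ (relDerivedSet : Set K₂ →o Set K₂)^[(c : ℕ)] Set.univ := by
          rintro _ ⟨n, hn, rfl⟩
          have h := hy n
          rwa [show (gs n).countP (fun f => δ ≤ ‖S f (F (g n :: gs n))‖) = c from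
            congrArg Fin.val hn] at h
        have hz' : z ∈ (relDerivedSet : Set K₂ →o Set K₂)^[(c : ℕ) + 1] Set.univ := by
          have h := hz.mono (Filter.principal_mono.2 hsub)
          rw [Function.iterate_succ_apply', (isClosed_iterate_relDerivedSet _).relDerivedSet_eq]
          exact h
        have hnear : {w | ∀ φ ∈ Φ, ‖φ z - φ w‖ < η / 2} ∈ nhds z := by
          refine (hΦ.eventually_all (p := fun φ w => ‖φ z - φ w‖ < η / 2)).2 fun φ _ => ?_
          have hcont : Continuous fun w => ‖φ z - φ w‖ := by fun_prop
          exact hcont.continuousAt.eventually_lt_const (by simpa using half_pos hη)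
        obtain ⟨_, ⟨hw, n, hn, rfl⟩, -⟩ := accPt_iff_nhds.1 hz _ hnear
        refine ⟨n, z, ?_, fun φ hφ => ?_⟩
        · rw [List.countP_cons_of_pos (by simpa using hsmall n)]
          rwa [show (gs n).countP (fun f => δ ≤ ‖S f (F (g n :: gs n))‖) = c from
            congrArg Fin.val hn]
        · have h1 := (hyφ n φ (Set.mem_insert_of_mem _ hφ)).trans (min_le_left _ _)
          have h2 := hw φ hφ
          have h3 := norm_sub_le_norm_sub_add_norm_sub (φ z) (φ (y n)) (φ (F (g n :: gs n)))
          linarith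
    obtain ⟨n, y, hy, hyη⟩ := hmain
    refine ⟨g n :: gs n, by simp [hlen], ?_, ?_, ?_, ?_, y, hy, hyη⟩
    · rintro f (_ | ⟨_, hf⟩)
      exacts [hg n, hgs n f hf]
    · rintro f (_ | ⟨_, hf⟩) z hz
      exacts [hgW n z fun h => hz (hWU n h), hsupp n f hf z fun h => hz (hWU n (hVW n h))]
    · refine List.pairwise_cons.2 ⟨fun f hf z => ?_, hsort n⟩
      change f z ≤ g n z
      by_cases hz : z ∈ V n
      · rw [hgV n z hz]
        exact (hgs n f hf z).2
      · rw [hsupp n f hf z hz]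
        exact (hg n z).1
    · obtain ⟨q, hqV, hq⟩ := hpeak n
      refine ⟨q, hWU n (hVW n hqV), ?_⟩
      rintro f (_ | ⟨_, hf⟩)
      exacts [hgV n q hqV, hq f hf]

open Classical in
/-- The chain attached to the rule choosing a point where `S (c gs)` attains its norm, when the
`k`-th derivative of `K₂` is empty. -/
theorem exists_chain_countP_lt [Nonempty K₂] (hE : ¬ ContainsCopyOfCZero E)
    (S : C(K₁, ℝ) →L[ℝ] C(K₂, E)) {δ : ℝ} (hδ : 0 < δ) {m k : ℕ}
    (h₁ : ((relDerivedSet : Set K₁ →o Set K₁)^[m] Set.univ).Nonempty)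
    (h₂ : (relDerivedSet : Set K₂ →o Set K₂)^[k] Set.univ = ∅)
    (c : List C(K₁, ℝ) → C(K₁, ℝ)) :
    ∃ (gs : List C(K₁, ℝ)) (y : K₂), gs.length = m ∧
      (∀ g ∈ gs, ∀ z, g z ∈ Set.Icc (0 : ℝ) 1) ∧ gs.Pairwise (fun f g => g ≤ f) ∧
      (∃ p, ∀ g ∈ gs, g p = 1) ∧ gs.countP (fun g => δ ≤ ‖S g y‖) < k ∧
      ‖S (c gs) y‖ = ‖S (c gs)‖ := by
  choose F hF using fun gs => exists_norm_apply_eq_norm (S (c gs))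
  obtain ⟨x, hx⟩ := h₁
  obtain ⟨gs, hlen, hgs, -, hsort, ⟨p, -, hp⟩, y, hy, -⟩ :=
    exists_chain_and_mem_derivative hE S hδ m F x Set.univ ∅ 1 hx isOpen_univ (Set.mem_univ x)
      Set.finite_empty one_pos
  refine ⟨gs, F gs, hlen, hgs, hsort, ⟨p, hp⟩, ?_, hF gs⟩
  by_contra! hk
  have h := antitone_iterate_relDerivedSet Set.univ hk hy
  simp [h₂] at h

variable [Nonempty K₂]

theorem three_le_of_derivative_eq_empty (hE : ¬ ContainsCopyOfCZero E)
    (S : C(K₁, ℝ) →L[ℝ] C(K₂, E)) {A B : ℝ} (hA0 : 0 ≤ A) (hB0 : 0 ≤ B)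
    (hA : ∀ f, ‖S f‖ ≤ A * ‖f‖)
    (hB : ∀ f, ‖f‖ ≤ B * ‖S f‖) {m k : ℕ} (hkm : k ≤ m)
    (h₁ : ((relDerivedSet : Set K₁ →o Set K₁)^[m] Set.univ).Nonempty)
    (h₂ : (relDerivedSet : Set K₂ →o Set K₂)^[k] Set.univ = ∅) :
    3 ≤ A * B := by
  classical
  refine le_of_forall_pos_le_add_mul (c := 2 * B) fun δ hδ => ?_
  obtain ⟨gs, y, hlen, hgs, hsort, ⟨p, hp⟩, hcount, hy⟩ := exists_chain_countP_lt hE S hδ h₁ h₂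
    -- The last bump is the smallest; the default 0 is never reached, as the list turns out
    -- nonempty.
    (fun gs => 1 + (2 : ℝ) • gs.getLastD 0)
  obtain ⟨g, hg, hsmall⟩ : ∃ g ∈ gs, ‖S g y‖ < δ := by
    by_contra! h
    rw [List.countP_eq_length.2 (by simpa using h)] at hcount
    omega
  have hne : gs ≠ [] := List.ne_nil_of_mem hg
  have : Std.Refl fun f g : C(K₁, ℝ) => g ≤ f := ⟨fun f => le_refl f⟩
  have hlast := hsort.rel_getLast hg
  have hmem := List.getLast_mem hne
  rw [List.getLastD_eq_getLast?, List.getLast?_eq_getLast_of_ne_nil hne, Option.getD_some] at hy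
  set w := gs.getLast hne
  have hf : 3 ≤ ‖1 + (2 : ℝ) • w‖ := by
    refine le_trans ?_ ((Real.le_norm_self _).trans (ContinuousMap.norm_coe_le_norm _ p))
    simp [hp w hmem]
    norm_num
  have hb : ‖1 + (2 : ℝ) • w - (2 : ℝ) • g‖ ≤ 1 := by
    refine (ContinuousMap.norm_le _ zero_le_one).2 fun z => ?_
    have h1 : w z ≤ g z := hlast z
    have h2 := (hgs g hg z).2
    have h3 := (hgs w hmem z).1
    simp only [ContinuousMap.sub_apply, ContinuousMap.add_apply, ContinuousMap.one_apply,
      ContinuousMap.smul_apply, smul_eq_mul, Real.norm_eq_abs]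
    rw [abs_le]
    constructor <;> linarith
  have h1 : ‖S (1 + (2 : ℝ) • w) y‖ ≤ A + 2 * δ := by
    have heq : S (1 + (2 : ℝ) • w) y = S (1 + (2 : ℝ) • w - (2 : ℝ) • g) y + (2 : ℝ) • S g y := by
      rw [map_sub S, map_smul S 2 g]
      simp
    rw [heq]
    refine (norm_add_le _ _).trans (add_le_add ?_ ?_)
    · refine (ContinuousMap.norm_coe_le_norm _ y).trans ((hA _).trans ?_)
      nlinarith
    · rw [norm_smul]
      simpa using hsmall.le
  rw [hy] at h1
  have h2 := hf.trans ((hB _).trans (mul_le_mul_of_nonneg_left h1 hB0))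
  linarith

theorem sub_half_le_mul_of_derivative_eq_empty (hE : ¬ ContainsCopyOfCZero E)
    (S : C(K₁, ℝ) →L[ℝ] C(K₂, E)) {A B : ℝ} (hA0 : 0 ≤ A) (hB0 : 0 ≤ B)
    (hA : ∀ f, ‖S f‖ ≤ A * ‖f‖)
    (hB : ∀ f, ‖f‖ ≤ B * ‖S f‖) {m k : ℕ}
    (h₁ : ((relDerivedSet : Set K₁ →o Set K₁)^[m] Set.univ).Nonempty)
    (h₂ : (relDerivedSet : Set K₂ →o Set K₂)^[k] Set.univ = ∅) :
    m - ((k : ℝ) - 1) / 2 ≤ A * B * (((k : ℝ) - 1) / 2) := by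
  classical
  refine le_of_forall_pos_le_add_mul (c := m * B) fun δ hδ => ?_
  -- At most k - 1 = 2h bumps are large at y, so subtracting h centres their sum in [-h, h].
  set h : ℝ := ((k : ℝ) - 1) / 2 with hh
  obtain ⟨gs, y, hlen, hgs, -, ⟨p, hp⟩, hcount, hy⟩ := exists_chain_countP_lt hE S hδ h₁ h₂
    (fun gs => (-h) • 1 + gs.sum)
  let q : C(K₁, ℝ) → Bool := fun g => δ ≤ ‖S g y‖
  have hcount' : ((gs.filter q).length : ℝ) ≤ 2 * h := by
    rw [← List.countP_eq_length_filter]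
    have : gs.countP q + 1 ≤ k := hcount
    have : ((gs.countP q : ℕ) : ℝ) + 1 ≤ k := by exact_mod_cast this
    rw [hh]
    linarith
  have h0 : 0 ≤ h := by
    have : (0 : ℝ) ≤ (gs.filter q).length := Nat.cast_nonneg _
    linarith
  have hf : m - h ≤ ‖(-h) • 1 + gs.sum‖ := by
    refine le_trans ?_ ((Real.le_norm_self _).trans (ContinuousMap.norm_coe_le_norm _ p))
    simp [sum_apply_eq_length hp, hlen]
  have hb : ‖(-h) • 1 + (gs.filter q).sum‖ ≤ h := by
    refine (ContinuousMap.norm_le _ h0).2 fun z => ?_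
    have h1 := sum_apply_mem_Icc_length (l := gs.filter q)
      (fun g hg => hgs g (List.mem_of_mem_filter hg)) z
    simp only [ContinuousMap.add_apply, ContinuousMap.one_apply,
      ContinuousMap.smul_apply, smul_eq_mul, Real.norm_eq_abs]
    rw [abs_le]
    constructor <;> linarith [h1.1, h1.2]
  have hrest : ‖S (gs.filter fun g => !q g).sum y‖ ≤ δ * m := by
    refine (norm_map_sum_le_length_mul (δ := δ) (evalAfter S y : C(K₁, ℝ) →+ E)
      fun g hg => ?_).trans ?_
    · have := (List.mem_filter.1 hg).2
      simp only [q, Bool.not_eq_true', decide_eq_false_iff_not, not_le] at this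
      exact this.le
    · rw [← hlen]
      exact mul_le_mul_of_nonneg_left (by exact_mod_cast List.length_filter_le _ _) hδ.le
  have h1 : ‖S ((-h) • 1 + gs.sum) y‖ ≤ A * h + δ * m := by
    have heq : S ((-h) • 1 + gs.sum) y = S ((-h) • 1 + (gs.filter q).sum) y +
        S (gs.filter fun g => !q g).sum y := by
      rw [← sum_sub_sum_filter_eq, ← ContinuousMap.add_apply, ← map_add]
      congr 2
      abel
    rw [heq]
    refine (norm_add_le _ _).trans (add_le_add ?_ hrest)
    exact (ContinuousMap.norm_coe_le_norm _ y).trans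
      ((hA _).trans (mul_le_mul_of_nonneg_left hb hA0))
  rw [hy] at h1
  have h2 := hf.trans ((hB _).trans (mul_le_mul_of_nonneg_left h1 hB0))
  linarith

end Chain

/-! ### Heights and finite derivatives -/

section Height

variable {X : Type*} [TopologicalSpace X]

theorem iterate_relDerivedSet_eq_empty_of_scatteredHeight_eq {n : ℕ} (hX : IsScatteredSpace X)
    (h : scatteredHeight X = n) : (relDerivedSet : Set X →o Set X)^[n] Set.univ = ∅ := by
  rw [← iteratedDerivedSet_natCast, ← h]
  exact csInf_mem hX

theorem iterate_relDerivedSet_nonempty_of_lt_scatteredHeight {n : ℕ}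
    (h : (n : Ordinal) < scatteredHeight X) :
    ((relDerivedSet : Set X →o Set X)^[n] Set.univ).Nonempty := by
  rw [← iteratedDerivedSet_natCast, Set.nonempty_iff_ne_empty]
  exact fun he => (csInf_le' (s := {α : Ordinal | (Set.univ : Set X)ᵈ[α] = ∅}) he).not_gt h

theorem isScatteredSpace_and_scatteredHeight_lt_omega0 {n : ℕ}
    (h : (relDerivedSet : Set X →o Set X)^[n] Set.univ = ∅) :
    IsScatteredSpace X ∧ scatteredHeight X < Ordinal.omega0 := by
  rw [← iteratedDerivedSet_natCast] at h
  exact ⟨⟨n, h⟩, (csInf_le' (s := {α : Ordinal | (Set.univ : Set X)ᵈ[α] = ∅}) h).trans_lt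
    (Ordinal.natCast_lt_omega0 n)⟩

end Height

/-! ### Reduction to scalar functions and conclusion -/

/-- An into isomorphism of `C(K₁, E₁)` restricts to an operator on the scalar functions. -/
theorem exists_scalar_restriction {K₁ K₂ E₁ E₂ : Type*} [TopologicalSpace K₁] [CompactSpace K₁]
    [TopologicalSpace K₂] [CompactSpace K₂]
    [NormedAddCommGroup E₁] [NormedSpace ℝ E₁] [Nontrivial E₁]
    [NormedAddCommGroup E₂] [NormedSpace ℝ E₂]
    (H : Submodule ℝ C(K₂, E₂)) (T : C(K₁, E₁) ≃L[ℝ] H) :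
    ∃ S : C(K₁, ℝ) →L[ℝ] C(K₂, E₂),
      (∀ f, ‖S f‖ ≤ ‖(T : C(K₁, E₁) →L[ℝ] H)‖ * ‖f‖) ∧
      ∀ f, ‖f‖ ≤ ‖(T.symm : H →L[ℝ] C(K₁, E₁))‖ * ‖S f‖ := by
  obtain ⟨e, he⟩ := exists_norm_eq E₁ (zero_le_one' ℝ)
  let J : C(K₁, ℝ) →L[ℝ] C(K₁, E₁) :=
    (ContinuousLinearMap.toSpanSingleton ℝ e).compLeftContinuous ℝ K₁
  have hJ : ∀ f, ‖J f‖ = ‖f‖ := fun f => by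
    have hz : ∀ z, ‖J f z‖ = ‖f z‖ := fun z => by
      simp [J, norm_smul, he]
    refine le_antisymm ?_ ?_ <;> refine (ContinuousMap.norm_le _ (norm_nonneg _)).2 fun z => ?_
    · rw [hz]
      exact f.norm_coe_le_norm z
    · rw [← hz]
      exact (J f).norm_coe_le_norm z
  refine ⟨H.subtypeL.comp ((T : C(K₁, E₁) →L[ℝ] H).comp J), fun f => ?_, fun f => ?_⟩
  · rw [← hJ f]
    exact (T : C(K₁, E₁) →L[ℝ] H).le_opNorm (J f)
  · have h := (T.symm : H →L[ℝ] C(K₁, E₁)).le_opNorm (T (J f))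
    simp only [ContinuousLinearEquiv.coe_coe, ContinuousLinearEquiv.symm_apply_apply, hJ] at h
    exact h

theorem corollary1p5
    (K₁ : Type*) [TopologicalSpace K₁] [CompactSpace K₁] [T2Space K₁] [Infinite K₁]
    (K₂ : Type*) [TopologicalSpace K₂] [CompactSpace K₂] [T2Space K₂] [Infinite K₂]
    (E₁ : Type*) [NormedAddCommGroup E₁] [NormedSpace ℝ E₁] [CompleteSpace E₁] [Nontrivial E₁]
    (E₂ : Type*) [NormedAddCommGroup E₂] [NormedSpace ℝ E₂] [CompleteSpace E₂] [Nontrivial E₂]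
    (hE₂ : ¬ ContainsCopyOfCZero E₂) :
    -- (i) an into isomorphism is a linear homeomorphism `T` onto a subspace `H` of `C(K₂, E₂)`
    (∀ l k : ℕ, k < l →
      IsScatteredSpace K₁ → scatteredHeight K₁ = l →
      IsScatteredSpace K₂ → scatteredHeight K₂ = k →
      ∀ (H : Submodule ℝ C(K₂, E₂)) (T : C(K₁, E₁) ≃L[ℝ] H),
        max 3 ((2 * (l : ℝ) - k - 1) / ((k : ℝ) - 1)) ≤
          ‖(T : C(K₁, E₁) →L[ℝ] H)‖ * ‖(T.symm : H →L[ℝ] C(K₁, E₁))‖) ∧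
    -- (ii)
    (EmbedsIsomorphically C(K₁, E₁) C(K₂, E₂) →
      IsScatteredSpace K₂ → scatteredHeight K₂ < Ordinal.omega0 →
      IsScatteredSpace K₁ ∧ scatteredHeight K₁ < Ordinal.omega0) := by
  refine ⟨fun l k hkl hs₁ hl hs₂ hk H T => ?_, fun ⟨H, ⟨T⟩⟩ hs₂ hht => ?_⟩
  · obtain ⟨S, hA, hB⟩ := exists_scalar_restriction H T
    have h₂ := iterate_relDerivedSet_eq_empty_of_scatteredHeight_eq hs₂ hk
    obtain ⟨m, rfl⟩ : ∃ m, l = m + 1 := ⟨l - 1, by omega⟩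
    have h₁ : ((relDerivedSet : Set K₁ →o Set K₁)^[m] Set.univ).Nonempty := by
      apply iterate_relDerivedSet_nonempty_of_lt_scatteredHeight
      rw [hl]
      exact_mod_cast m.lt_succ_self
    refine max_le (three_le_of_derivative_eq_empty hE₂ S (ContinuousLinearMap.opNorm_nonneg _)
      (ContinuousLinearMap.opNorm_nonneg _) hA hB
      (Nat.lt_succ_iff.1 hkl) h₁ h₂) ?_
    have h := sub_half_le_mul_of_derivative_eq_empty hE₂ S (ContinuousLinearMap.opNorm_nonneg _)
      (ContinuousLinearMap.opNorm_nonneg _)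
      hA hB h₁ h₂
    -- An infinite compact space has an accumulation point, so its first derivative is nonempty.
    have hk1 : 1 < k := by
      by_contra! hk1
      have h3 := antitone_iterate_relDerivedSet (Set.univ : Set K₂) hk1
      obtain ⟨z, hz⟩ := (Set.infinite_univ (α := K₂)).exists_accPt_principal
      simp only [h₂, Function.iterate_one, Set.subset_empty_iff] at h3
      have : z ∈ (relDerivedSet (Set.univ : Set K₂)) := ⟨hz, Set.mem_univ z⟩
      simp [h3] at this
    have hk1' : (0 : ℝ) < k - 1 := by
      rw [sub_pos]
      exact_mod_cast hk1
    rw [div_le_iff₀ hk1']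
    push_cast
    linarith
  · obtain ⟨S, hA, hB⟩ := exists_scalar_restriction H T
    obtain ⟨k, hk⟩ := Ordinal.lt_omega0.1 hht
    have h₂ := iterate_relDerivedSet_eq_empty_of_scatteredHeight_eq hs₂ hk
    obtain ⟨m, hm⟩ := exists_nat_gt
      (‖(T : C(K₁, E₁) →L[ℝ] H)‖ * ‖(T.symm : H →L[ℝ] C(K₁, E₁))‖ * (((k : ℝ) - 1) / 2) +
        ((k : ℝ) - 1) / 2)
    refine isScatteredSpace_and_scatteredHeight_lt_omega0 (n := m) ?_
    by_contra! h₁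
    have h := sub_half_le_mul_of_derivative_eq_empty hE₂ S (ContinuousLinearMap.opNorm_nonneg _)
      (ContinuousLinearMap.opNorm_nonneg _)
      hA hB h₁ h₂
    linarith
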